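/- Let $N\ge 2$ be an integer. Consider the discrete Sturm–Liouville equation $$-\nabla(f_n\Delta y_n)+q_ny_n=\lambda w_ny_n,\qquad n=1,\dots,N,\qquad(1)$$ where $\Delta y_n=y_{n+1}-y_n$, $\nabla y_n=y_n-y_{n-1}$. Let $\Omega_N^{\mathbb R,+}\subset\mathbb R^{3N+1}$ be the space of equations $(1/f,q,w)$ with real coefficients such that $f_n\ne0$ for $0\le n\le N$ and $w_n>0$ for $1\le n\le N$. Let $\mathcal B^{\mathbb C}$ be the space of self-adjoint boundary conditions: its elements are the classes $[A\,|\,B]$ of pairs of complex $2\times2$ matrices with $\operatorname{rank}(A,B)=2$ and $AEA^*=BEB^*$, $E=\begin{pmatrix}0&1\\-1&0\end{pmatrix}$, modulo $(A,B)\sim(TA,TB)$, $T\in GL(2,\mathbb C)$; it carries the topology induced by the quotient topology on all classes $[A\,|\,B]$ with $\operatorname{rank}(A,B)=2$. A number $\lambda\in\mathbb C$ is an eigenvalue of the problem $(\omega,[A\,|\,B])$, $\omega=(1/f,q,w)$, if there is a non-zero $y=(y_0,\dots,y_{N+1})\in\mathbb C^{N+2}$ that satisfies (1) and $$A\begin{pmatrix}y_0\\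 f_0\Delta y_0\end{pmatrix}+B\begin{pmatrix}y_N\\ f_N\Delta y_N\end{pmatrix}=0.$$ A continuous eigenvalue branch with domain $D\subset\Omega_N^{\mathbb R,+}\times\mathcal B^{\mathbb C}$ is a continuous function $\Lambda:D\to\mathbb R$ such that $\Lambda(\sigma,\mathbf B)$ is an eigenvalue (simple or not) of $(\sigma,\mathbf B)$ for every $(\sigma,\mathbf B)\in D$. **Theorem.** Let $\omega\in\Omega_N^{\mathbb R,+}$. Then every continuous eigenvalue branch $\Lambda$ (with any domain $D$) is non-strictly increasing in the two real coordinate directions of each of the four coordinate systems of $\mathcal B^{\mathbb C}$ $$\mathcal O_{1,3}^{\mathbb C}=\left\{\left[\begin{array}{cccc}1&a_{12}&0&\bar z\\0&z&-1&b_{22}\end{array}\right]\right\},\qquad \mathcal O_{1,4}^{\mathbb C}=\left\{\left[\begin{array}{cccc}1&a_{12}&\bar z&0\\0&z&b_{21}&1\end{array}\right]\right\},$$ $$\mathcal O_{2,3}^{\mathbb C}=\left\{\left[\begin{array}{cccc}a_{11}&-1&0&\bar z\\z&0&-1&b_{22}\end{array}\right]\right\},\qquad \mathcal O_{2,4}^{\mathbb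 C}=\left\{\left[\begin{array}{cccc}a_{11}&-1&\bar z&0\\z&0&b_{21}&1\end{array}\right]\right\},$$ where $z\in\mathbb C$ and the coordinates $a_{ij},b_{ij}$ are real. That is, in the directions $a_{12}$ and $b_{22}$ in $\mathcal O_{1,3}^{\mathbb C}$, $a_{12}$ and $b_{21}$ in $\mathcal O_{1,4}^{\mathbb C}$, $a_{11}$ and $b_{22}$ in $\mathcal O_{2,3}^{\mathbb C}$, $a_{11}$ and $b_{21}$ in $\mathcal O_{2,4}^{\mathbb C}$: if $\omega$, $z$ and the other real coordinate are fixed and $\mathbf A(s)$ denotes the boundary condition whose remaining real coordinate is $s$, then for every interval $I\subset\mathbb R$ with $(\omega,\mathbf A(s))\in D$ for all $s\in I$, the function $s\mapsto\Lambda(\omega,\mathbf A(s))$ is non-decreasing on $I$. -/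

import Mathlib

open Matrix ComplexConjugate

noncomputable section

namespace DiscreteSL

/-! ### Equations -/

/-- The space of discrete Sturm-Liouville equations
`-∇(fₙ Δyₙ) + qₙ yₙ = λ wₙ yₙ`, `n ∈ [1, N]`, with real coefficients, `fₙ ≠ 0` for `n ∈ [0, N]`
and `wₙ > 0` for `n ∈ [1, N]`. An equation is the triple `(1/f, q, w)`, an element of `ℝ^(3N+1)`,
and the topology is the one induced from `ℝ^(3N+1)`. The `1/f`-component is indexed by
`n = 0, …, N`; the entry of `q`, `w` at the index `i : Fin N` is `q_{i+1}`, `w_{i+1}`. -/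
def RealEqn (N : ℕ) : Type :=
  {ω : (Fin (N + 1) → ℝ) × (Fin N → ℝ) × (Fin N → ℝ) //
    (∀ n, ω.1 n ≠ 0) ∧ ∀ n, 0 < ω.2.2 n}

instance (N : ℕ) : TopologicalSpace (RealEqn N) := instTopologicalSpaceSubtype

namespace RealEqn

variable {N : ℕ}

/-- The coefficient `fₙ`, `n ∈ [0, N]`. -/
def f (ω : RealEqn N) (n : Fin (N + 1)) : ℝ := (ω.1.1 n)⁻¹

/-- The coefficient `q_{i+1}`. -/
def q (ω : RealEqn N) (i : Fin N) : ℝ := ω.1.2.1 i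

/-- The weight `w_{i+1}`. -/
def w (ω : RealEqn N) (i : Fin N) : ℝ := ω.1.2.2 i

/-- The quasi-difference `fₙ Δyₙ = fₙ (yₙ₊₁ - yₙ)`, `n ∈ [0, N]`, of `y = (y₀, …, y_{N+1})`. -/
def quasiDiff (ω : RealEqn N) (y : Fin (N + 2) → ℂ) (n : Fin (N + 1)) : ℂ :=
  (ω.f n : ℂ) * (y n.succ - y n.castSucc)

/-- `y = (y₀, …, y_{N+1})` solves `-∇(fₙ Δyₙ) + qₙ yₙ = μ wₙ yₙ` for all `n = i + 1 ∈ [1, N]`. -/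
def IsSolution (ω : RealEqn N) (μ : ℂ) (y : Fin (N + 2) → ℂ) : Prop :=
  ∀ i : Fin N,
    -(ω.quasiDiff y i.succ - ω.quasiDiff y i.castSucc) + (ω.q i : ℂ) * y i.succ.castSucc
      = μ * (ω.w i : ℂ) * y i.succ.castSucc

end RealEqn

/-! ### Boundary conditions -/

/-- Pairs `(A, B)` of complex `2 × 2` matrices for which the `2 × 4` matrix `(A, B)` has rank 2,
with the topology induced from `ℂ^(2×4)`. -/
def BCMatrix : Type :=
  {M : Matrix (Fin 2) (Fin 2) ℂ × Matrix (Fin 2) (Fin 2) ℂ // (fromCols M.1 M.2).rank = 2}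

instance : TopologicalSpace BCMatrix := instTopologicalSpaceSubtype

/-- `(A₁, B₁) ∼ (A, B)` if and only if `(A₁, B₁) = (T A, T B)` for an invertible `T`. -/
instance bcSetoid : Setoid BCMatrix where
  r M M' := ∃ T : GL (Fin 2) ℂ,
    M'.1.1 = (T : Matrix (Fin 2) (Fin 2) ℂ) * M.1.1 ∧
    M'.1.2 = (T : Matrix (Fin 2) (Fin 2) ℂ) * M.1.2
  iseqv :=
    { refl := fun M => ⟨1, by simp, by simp⟩
      symm := by
        rintro M M' ⟨T, h1, h2⟩
        have hT : ((T⁻¹ : GL (Fin 2) ℂ) : Matrix (Fin 2) (Fin 2) ℂ)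
            * (T : Matrix (Fin 2) (Fin 2) ℂ) = 1 := by
          rw [← Units.val_mul, inv_mul_cancel, Units.val_one]
        exact ⟨T⁻¹, by rw [h1, ← Matrix.mul_assoc, hT, Matrix.one_mul],
          by rw [h2, ← Matrix.mul_assoc, hT, Matrix.one_mul]⟩
      trans := by
        rintro M M' M'' ⟨T, h1, h2⟩ ⟨S, h3, h4⟩
        exact ⟨S * T, by rw [h3, h1, Units.val_mul, Matrix.mul_assoc],
          by rw [h4, h2, Units.val_mul, Matrix.mul_assoc]⟩ }

/-- The space of boundary conditions `[A | B]`, with the quotient topology. -/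
def BC : Type := Quotient bcSetoid

instance : TopologicalSpace BC := instTopologicalSpaceQuotient

lemma mulVec_add_eq_zero_iff (T : GL (Fin 2) ℂ) (A B : Matrix (Fin 2) (Fin 2) ℂ)
    (u v : Fin 2 → ℂ) :
    ((T : Matrix (Fin 2) (Fin 2) ℂ) * A) *ᵥ u + ((T : Matrix (Fin 2) (Fin 2) ℂ) * B) *ᵥ v = 0
      ↔ A *ᵥ u + B *ᵥ v = 0 := by
  rw [← mulVec_mulVec, ← mulVec_mulVec, ← mulVec_add]
  constructor
  · intro h
    have h2 := congrArg (fun x => ((T⁻¹ : GL (Fin 2) ℂ) : Matrix (Fin 2) (Fin 2) ℂ) *ᵥ x) h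
    simp only [mulVec_mulVec, mulVec_zero] at h2
    rwa [← Units.val_mul, inv_mul_cancel, Units.val_one, one_mulVec] at h2
  · intro h
    rw [h, mulVec_zero]

lemma selfAdjoint_iff (T : GL (Fin 2) ℂ) (A B E : Matrix (Fin 2) (Fin 2) ℂ) :
    ((T : Matrix (Fin 2) (Fin 2) ℂ) * A) * E * ((T : Matrix (Fin 2) (Fin 2) ℂ) * A)ᴴ
        = ((T : Matrix (Fin 2) (Fin 2) ℂ) * B) * E * ((T : Matrix (Fin 2) (Fin 2) ℂ) * B)ᴴ
      ↔ A * E * Aᴴ = B * E * Bᴴ := by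
  have key : ∀ C : Matrix (Fin 2) (Fin 2) ℂ,
      ((T : Matrix (Fin 2) (Fin 2) ℂ) * C) * E * ((T : Matrix (Fin 2) (Fin 2) ℂ) * C)ᴴ
        = (T : Matrix (Fin 2) (Fin 2) ℂ) * (C * E * Cᴴ) * (T : Matrix (Fin 2) (Fin 2) ℂ)ᴴ := by
    intro C
    simp only [conjTranspose_mul, Matrix.mul_assoc]
  rw [key, key]
  have hT : IsUnit (T : Matrix (Fin 2) (Fin 2) ℂ) := T.isUnit
  have hT' : IsUnit (T : Matrix (Fin 2) (Fin 2) ℂ)ᴴ := hT.star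
  exact ⟨fun h => hT.mul_left_cancel (hT'.mul_right_cancel h), fun h => by rw [h]⟩

/-- The boundary condition `[A | B]` holds for the boundary data `u`, `v`: `A u + B v = 0`. -/
def BC.Holds (X : BC) (u v : Fin 2 → ℂ) : Prop :=
  Quotient.liftOn X (fun M => M.1.1 *ᵥ u + M.1.2 *ᵥ v = 0) (by
    rintro M M' ⟨T, h1, h2⟩
    simp only [h1, h2, mulVec_add_eq_zero_iff])

/-- The boundary condition `[A | B]` is self-adjoint: `A E A* = B E B*`, `E = (0, 1; -1, 0)`. -/
def BC.IsSelfAdj (X : BC) : Prop :=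
  Quotient.liftOn X
    (fun M => M.1.1 * !![0, 1; -1, 0] * M.1.1ᴴ = M.1.2 * !![0, 1; -1, 0] * M.1.2ᴴ) (by
    rintro M M' ⟨T, h1, h2⟩
    simp only [h1, h2, selfAdjoint_iff])

/-- The space of self-adjoint boundary conditions, a topological subspace of `BC`. -/
def SelfAdjBC : Type := {X : BC // X.IsSelfAdj}

instance : TopologicalSpace SelfAdjBC := instTopologicalSpaceSubtype

lemma rank_fromCols_eq_two (A B P Q : Matrix (Fin 2) (Fin 2) ℂ) (h : A * P + B * Q = 1) :
    (fromCols A B).rank = 2 := by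
  apply le_antisymm
  · simpa using rank_le_card_height (fromCols A B)
  · have h1 : fromCols A B * fromRows P Q = 1 := by rw [fromCols_mul_fromRows, h]
    have h2 := rank_mul_le_left (fromCols A B) (fromRows P Q)
    rw [h1, rank_one] at h2
    simpa using h2

/-- The boundary condition `[A | B]`, where `(P; Q)` is a right inverse of `(A, B)`. -/
def SelfAdjBC.mk (A B P Q : Matrix (Fin 2) (Fin 2) ℂ) (h : A * P + B * Q = 1)
    (hs : A * !![0, 1; -1, 0] * Aᴴ = B * !![0, 1; -1, 0] * Bᴴ) : SelfAdjBC :=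
  ⟨Quotient.mk bcSetoid ⟨(A, B), rank_fromCols_eq_two A B P Q h⟩, hs⟩

/-! ### The four coordinate systems

Each of the four maps below sends the coordinates (two real ones and one complex one) to the
boundary condition with the displayed normalized coefficient matrices. The range of the map is the
coordinate system, and the map is the inverse of the coordinate chart. -/

/-- The coordinate system `O₁₃`: `[1, a₁₂, 0, z̄; 0, z, -1, b₂₂]`. -/
def chart13 (a12 : ℝ) (z : ℂ) (b22 : ℝ) : SelfAdjBC :=
  SelfAdjBC.mk !![1, (a12 : ℂ); 0, z] !![0, conj z; -1, (b22 : ℂ)]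
    !![1, 0; 0, 0] !![0, -1; 0, 0]
    (by ext i j; fin_cases i <;> fin_cases j <;> simp)
    (by ext i j; fin_cases i <;> fin_cases j <;>
          simp [Matrix.mul_apply, Fin.sum_univ_two])

/-- The coordinate system `O₁₄`: `[1, a₁₂, z̄, 0; 0, z, b₂₁, 1]`. -/
def chart14 (a12 : ℝ) (z : ℂ) (b21 : ℝ) : SelfAdjBC :=
  SelfAdjBC.mk !![1, (a12 : ℂ); 0, z] !![conj z, 0; (b21 : ℂ), 1]
    !![1, 0; 0, 0] !![0, 0; 0, 1]
    (by ext i j; fin_cases i <;> fin_cases j <;> simp)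
    (by ext i j; fin_cases i <;> fin_cases j <;>
          simp [Matrix.mul_apply, Fin.sum_univ_two])

/-- The coordinate system `O₂₃`: `[a₁₁, -1, 0, z̄; z, 0, -1, b₂₂]`. -/
def chart23 (a11 : ℝ) (z : ℂ) (b22 : ℝ) : SelfAdjBC :=
  SelfAdjBC.mk !![(a11 : ℂ), -1; z, 0] !![0, conj z; -1, (b22 : ℂ)]
    !![0, 0; -1, 0] !![0, -1; 0, 0]
    (by ext i j; fin_cases i <;> fin_cases j <;> simp)
    (by ext i j; fin_cases i <;> fin_cases j <;>
          simp [Matrix.mul_apply, Fin.sum_univ_two])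

/-- The coordinate system `O₂₄`: `[a₁₁, -1, z̄, 0; z, 0, b₂₁, 1]`. -/
def chart24 (a11 : ℝ) (z : ℂ) (b21 : ℝ) : SelfAdjBC :=
  SelfAdjBC.mk !![(a11 : ℂ), -1; z, 0] !![conj z, 0; (b21 : ℂ), 1]
    !![0, 0; -1, 0] !![0, 0; 0, 1]
    (by ext i j; fin_cases i <;> fin_cases j <;> simp)
    (by ext i j; fin_cases i <;> fin_cases j <;>
          simp [Matrix.mul_apply, Fin.sum_univ_two])

/-! ### Eigenvalues and continuous eigenvalue branches -/

/-- `μ` is an eigenvalue of the problem `(ω, X)`: there is a non-trivial solution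
`y = (y₀, …, y_{N+1})` of the equation with
`A (y₀, f₀ Δy₀)ᵀ + B (y_N, f_N Δy_N)ᵀ = 0`. -/
def IsEigenvalue {N : ℕ} (ω : RealEqn N) (X : BC) (μ : ℂ) : Prop :=
  ∃ y : Fin (N + 2) → ℂ, y ≠ 0 ∧ ω.IsSolution μ y ∧
    X.Holds ![y 0, ω.quasiDiff y 0]
      ![y (Fin.last N).castSucc, ω.quasiDiff y (Fin.last N)]

/-- `Λ` is a continuous eigenvalue branch with domain `D`, a set of self-adjoint problems: `Λ` is
real-valued and continuous on `D`, and its value at each problem in `D` is an eigenvalue of that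
problem, of whatever multiplicity. The domain may be any set: a neighbourhood of a problem
in the space of all self-adjoint problems, or a set of problems with one and the same equation. -/
def IsContinuousEigenvalueBranch {N : ℕ} (D : Set (RealEqn N × SelfAdjBC))
    (Λ : RealEqn N × SelfAdjBC → ℝ) : Prop :=
  ContinuousOn Λ D ∧ ∀ p ∈ D, IsEigenvalue p.1 p.2.1 (Λ p : ℂ)

/-- `Λ`, with domain `D`, is (non-strictly) increasing along the curve `c`: it is so on every
parameter interval on which `c` runs inside `D`. -/
def IncreasingAlong {α : Type*} (D : Set α) (Λ : α → ℝ) (c : ℝ → α) : Prop :=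
  ∀ I : Set ℝ, I.OrdConnected → Set.MapsTo c I D → MonotoneOn (fun s => Λ (c s)) I

end DiscreteSL

end

open Filter Topology

noncomputable section

namespace DiscreteSL

/-! ### The Lagrange identity -/

section Lagrange

variable {N : ℕ}

/-! For solutions at real parameters, the Lagrange identity equates the parameter difference times
the weighted inner product with the difference of the brackets of the boundary data at `N` and at
`0`. When the data satisfy two boundary conditions differing only in a real coordinate, `s` against
`t`, that difference is `(s - t) φ(u, v) conj (φ(u', v'))`, with `φ` one component of the data.
Hence a difference quotient of the branch equals `ψ(y) conj (ψ(x)) / ⟨y, x⟩`, where `ψ` evaluates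
`φ` on eigenfunctions.

Multiplicity does no harm: neither differentiability nor a continuous choice of eigenfunctions is
needed. Normalized eigenfunctions at parameters decreasing to `s` subconverge to an eigenfunction
`x` at `s`. Compared with this `x`, the quotients tend to `|ψ(x)|² / ⟨x, x⟩ ≥ 0` along the
subsequence, and a one-sided Dini derivative criterion gives monotonicity. -/

/-- The sesquilinear form `∑ wₙ yₙ x̄ₙ`, the sum being over `n ∈ [1, N]`. -/
def RealEqn.weightedInner (ω : RealEqn N) (y x : Fin (N + 2) → ℂ) : ℂ :=
  ∑ i : Fin N, (ω.w i : ℂ) * y i.succ.castSucc * conj (x i.succ.castSucc)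

/-- The bracket `u₀ ū'₁ - u₁ ū'₀` of two vectors of boundary data. -/
def bracket (u u' : Fin 2 → ℂ) : ℂ := u 0 * conj (u' 1) - u 1 * conj (u' 0)

/-- The vector `(yₙ, fₙ Δyₙ)`, `n ∈ [0, N]`. -/
def RealEqn.data (ω : RealEqn N) (y : Fin (N + 2) → ℂ) (n : Fin (N + 1)) : Fin 2 → ℂ :=
  ![y n.castSucc, ω.quasiDiff y n]

lemma RealEqn.f_ne_zero (ω : RealEqn N) (n : Fin (N + 1)) : (ω.f n : ℂ) ≠ 0 := by
  exact_mod_cast inv_ne_zero (ω.2.1 n)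

lemma RealEqn.w_pos (ω : RealEqn N) (i : Fin N) : 0 < ω.w i := ω.2.2 i

@[fun_prop]
lemma RealEqn.continuous_quasiDiff (ω : RealEqn N) (n : Fin (N + 1)) :
    Continuous fun y : Fin (N + 2) → ℂ => ω.quasiDiff y n := by
  unfold RealEqn.quasiDiff
  fun_prop

@[fun_prop]
lemma RealEqn.continuous_data (ω : RealEqn N) (n : Fin (N + 1)) :
    Continuous fun y : Fin (N + 2) → ℂ => ω.data y n := by
  refine continuous_pi fun j => ?_
  fin_cases j
  · simpa [RealEqn.data] using continuous_apply n.castSucc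
  · simpa [RealEqn.data] using ω.continuous_quasiDiff n

lemma RealEqn.continuous_weightedInner_left (ω : RealEqn N) (x : Fin (N + 2) → ℂ) :
    Continuous fun y => ω.weightedInner y x := by
  unfold RealEqn.weightedInner
  fun_prop

lemma RealEqn.data_smul (ω : RealEqn N) (c : ℂ) (y : Fin (N + 2) → ℂ) (n : Fin (N + 1)) :
    ω.data (c • y) n = c • ω.data y n := by
  ext j
  fin_cases j
  · simp [RealEqn.data]
  · simp [RealEqn.data, RealEqn.quasiDiff]
    ring

lemma RealEqn.IsSolution.smul {ω : RealEqn N} {μ : ℂ} {y : Fin (N + 2) → ℂ}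
    (h : ω.IsSolution μ y) (c : ℂ) : ω.IsSolution μ (c • y) := by
  intro i
  have hi := h i
  simp only [RealEqn.quasiDiff, Pi.smul_apply, smul_eq_mul] at hi ⊢
  linear_combination c * hi

/-- Since `f` is real, replacing both `yₙ` and `xₙ` by `yₙ₊₁` and `xₙ₊₁` leaves the bracket at `n`
unchanged. Only the jumps of the quasi-differences then contribute; the equations supply them, and
the real `q` terms cancel. -/
lemma RealEqn.bracket_succ_sub (ω : RealEqn N) {l m : ℝ} {y x : Fin (N + 2) → ℂ}
    (hy : ω.IsSolution l y) (hx : ω.IsSolution m x) (i : Fin N) :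
    bracket (ω.data y i.succ) (ω.data x i.succ)
        - bracket (ω.data y i.castSucc) (ω.data x i.castSucc)
      = ((l : ℂ) - m) * ((ω.w i : ℂ) * y i.succ.castSucc * conj (x i.succ.castSucc)) := by
  have h1 := hy i
  have h2 := congrArg conj (hx i)
  have e : i.castSucc.succ = i.succ.castSucc := Fin.succ_castSucc i
  simp only [bracket, RealEqn.data, RealEqn.quasiDiff, Matrix.cons_val_zero, Matrix.cons_val_one,
    map_add, map_sub, map_neg, map_mul, Complex.conj_ofReal, e] at h1 h2 ⊢
  linear_combination conj (x i.succ.castSucc) * h1 - y i.succ.castSucc * h2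

lemma Fin.sum_succ_sub_castSucc {M : Type*} [AddCommGroup M] {n : ℕ} (F : Fin (n + 1) → M) :
    ∑ i : Fin n, (F i.succ - F i.castSucc) = F (Fin.last n) - F 0 := by
  have h1 := Fin.sum_univ_succ F
  have h2 := Fin.sum_univ_castSucc F
  rw [Finset.sum_sub_distrib, sub_eq_sub_iff_add_eq_add, add_comm, ← h1, h2, add_comm]

/-- **Lagrange identity** for solutions at two real spectral parameters. -/
theorem RealEqn.lagrange_identity (ω : RealEqn N) {l m : ℝ} {y x : Fin (N + 2) → ℂ}
    (hy : ω.IsSolution l y) (hx : ω.IsSolution m x) :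
    bracket (ω.data y (Fin.last N)) (ω.data x (Fin.last N)) - bracket (ω.data y 0) (ω.data x 0)
      = ((l : ℂ) - m) * ω.weightedInner y x := by
  rw [RealEqn.weightedInner, Finset.mul_sum,
    ← Fin.sum_succ_sub_castSucc fun n => bracket (ω.data y n) (ω.data x n)]
  exact Finset.sum_congr rfl fun i _ => ω.bracket_succ_sub hy hx i

lemma RealEqn.weightedInner_self (ω : RealEqn N) (y : Fin (N + 2) → ℂ) :
    ω.weightedInner y y
      = ((∑ i : Fin N, ω.w i * Complex.normSq (y i.succ.castSucc) : ℝ) : ℂ) := by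
  simp [RealEqn.weightedInner, mul_assoc, Complex.mul_conj]

/-- A solution that vanishes on `[1, N]`, where `2 ≤ N`, vanishes at `0` and `N + 1` too. -/
lemma RealEqn.IsSolution.eq_zero {ω : RealEqn N} (hN : 2 ≤ N) {μ : ℂ} {y : Fin (N + 2) → ℂ}
    (hy : ω.IsSolution μ y) (h : ∀ i : Fin N, y i.succ.castSucc = 0) : y = 0 := by
  obtain ⟨k, rfl⟩ : ∃ k, N = k + 2 := ⟨N - 2, by omega⟩
  have inner : ∀ n : Fin (k + 2 + 2), n.val ≠ 0 → n.val ≠ k + 3 → y n = 0 := by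
    intro n h0 h1
    have := h ⟨n.val - 1, by omega⟩
    convert this using 2
    ext
    simp
    omega
  ext n
  rcases eq_or_ne n 0 with rfl | h0
  · have h1 := hy 0
    have e1 : y (Fin.succ (Fin.castSucc (0 : Fin (k + 2)))) = 0 :=
      inner _ (by simp) (by simp)
    have e2 : y (Fin.succ (Fin.succ (0 : Fin (k + 2)))) = 0 :=
      inner _ (by simp only [Fin.val_succ, Fin.val_zero]; omega)
        (by simp only [Fin.val_succ, Fin.val_zero]; omega)
    have e3 : y (Fin.castSucc (Fin.succ (0 : Fin (k + 2)))) = 0 :=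
      inner _ (by simp) (by simp)
    simp only [RealEqn.quasiDiff, e1, e2, e3] at h1
    have h2 : (ω.f (Fin.castSucc (0 : Fin (k + 2))) : ℂ) * y 0 = 0 := by
      have e4 : (Fin.castSucc (Fin.castSucc (0 : Fin (k + 2)))) = 0 := rfl
      rw [e4] at h1
      linear_combination -h1
    exact (mul_eq_zero.mp h2).resolve_left (ω.f_ne_zero _)
  rcases eq_or_ne n (Fin.last _) with rfl | h1
  · have h1 := hy (Fin.last (k + 1))
    have e1 : y (Fin.castSucc (Fin.castSucc (Fin.last (k + 1)))) = 0 :=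
      inner _ (by simp) (by simp)
    have e2 : y (Fin.succ (Fin.castSucc (Fin.last (k + 1)))) = 0 :=
      inner _ (by simp) (by simp)
    have e3 : y (Fin.castSucc (Fin.succ (Fin.last (k + 1)))) = 0 :=
      inner _ (by simp) (by simp)
    have e4 : (Fin.succ (Fin.succ (Fin.last (k + 1)))) = Fin.last (k + 2 + 1) := rfl
    simp only [RealEqn.quasiDiff, e1, e2, e3, e4] at h1
    have h2 : (ω.f (Fin.succ (Fin.last (k + 1))) : ℂ) * y (Fin.last (k + 2 + 1)) = 0 := by
      linear_combination -h1
    exact (mul_eq_zero.mp h2).resolve_left (ω.f_ne_zero _)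
  · exact inner n (fun h => h0 (Fin.ext h)) fun h => h1 (Fin.ext h)

/-- The weighted form ignores the indices `0` and `N + 1`, so it is definite only on solutions,
which their interior values determine to be zero or not. -/
lemma RealEqn.IsSolution.weightedInner_self_pos {ω : RealEqn N} (hN : 2 ≤ N) {μ : ℂ}
    {y : Fin (N + 2) → ℂ} (hy : ω.IsSolution μ y) (h0 : y ≠ 0) :
    0 < ∑ i : Fin N, ω.w i * Complex.normSq (y i.succ.castSucc) := by
  have hnn : ∀ i ∈ Finset.univ, 0 ≤ ω.w i * Complex.normSq (y i.succ.castSucc) :=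
    fun i _ => mul_nonneg (ω.w_pos i).le (Complex.normSq_nonneg _)
  refine lt_of_le_of_ne (Finset.sum_nonneg hnn) fun h => h0 (hy.eq_zero hN fun i => ?_)
  have := (Finset.sum_eq_zero_iff_of_nonneg hnn).mp h.symm i (Finset.mem_univ i)
  exact Complex.normSq_eq_zero.mp ((mul_eq_zero.mp this).resolve_left (ω.w_pos i).ne')

lemma RealEqn.isClosed_isSolution (ω : RealEqn N) :
    IsClosed {p : ℝ × (Fin (N + 2) → ℂ) | ω.IsSolution (p.1 : ℂ) p.2} := by
  simp only [RealEqn.IsSolution, Set.ofPred_forall, RealEqn.quasiDiff]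
  exact isClosed_iInter fun i => isClosed_eq (by fun_prop) (by fun_prop)

end Lagrange

/-! ### Monotonicity -/

/-- A continuous function with a right difference quotient that is frequently almost non-negative
is increasing. -/
lemma monotoneOn_of_frequently_slope {I : Set ℝ} (hI : I.OrdConnected) {L : ℝ → ℝ}
    (hL : ContinuousOn L I)
    (h : ∀ s ∈ I, ∀ b ∈ I, s < b → ∀ r < 0, ∃ᶠ t in 𝓝[>] s, r < slope L s t) :
    MonotoneOn L I := by
  intro a ha b hb hab
  have hsub : Set.Icc a b ⊆ I := hI.out ha hb
  -- The criterion bounds functions from above, so it is applied to `-L` against the constant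
  -- barrier `-L a`.
  have key := image_le_of_liminf_slope_right_le_deriv_boundary
    (f := fun t => -L t) (a := a) (b := b) (hL.mono hsub).neg
    (B := fun _ => -L a) (B' := fun _ => 0) le_rfl continuousOn_const
    (fun x _ => hasDerivWithinAt_const _ _ _) (fun x hx r hr => ?_) (Set.right_mem_Icc.mpr hab)
  · linarith
  · refine (h x (hsub (Set.Ico_subset_Icc_self hx)) b hb hx.2 (-r) (by linarith)).mono
      fun t ht => ?_
    simp only [slope_def_field] at ht ⊢
    have : (-L t - -L x) / (t - x) = -((L t - L x) / (t - x)) := by ring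
    linarith

variable {N : ℕ}

/-- If the boundary data `u`, `v` of the boundary conditions with parameter `s` satisfy
`[v, v'] - [u, u'] = (s - t) φ(u, v) conj (φ(u', v'))`, then continuous real eigenvalues increase
with the parameter: the derivative is `|φ|²` at a normalized eigenfunction. -/
theorem monotoneOn_eigenvalue (hN : 2 ≤ N) (ω : RealEqn N) {I : Set ℝ} (hI : I.OrdConnected)
    {A B : ℝ → Matrix (Fin 2) (Fin 2) ℂ} (hA : Continuous A) (hB : Continuous B)
    {φ : (Fin 2 → ℂ) → (Fin 2 → ℂ) → ℂ} (hφ : Continuous fun p : (Fin 2 → ℂ) × _ => φ p.1 p.2)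
    (hform : ∀ s t : ℝ, ∀ u v u' v', A s *ᵥ u + B s *ᵥ v = 0 → A t *ᵥ u' + B t *ᵥ v' = 0 →
      bracket v v' - bracket u u' = ((s : ℂ) - t) * (φ u v * conj (φ u' v')))
    {L : ℝ → ℝ} (hL : ContinuousOn L I)
    (heig : ∀ s ∈ I, ∃ y : Fin (N + 2) → ℂ, y ≠ 0 ∧ ω.IsSolution (L s : ℂ) y ∧
      A s *ᵥ ω.data y 0 + B s *ᵥ ω.data y (Fin.last N) = 0) :
    MonotoneOn L I := by
  refine monotoneOn_of_frequently_slope hI hL fun s hs b hb hsb r hr => ?_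
  have hnorm : ∀ t ∈ I, ∃ y : Fin (N + 2) → ℂ, y ∈ Metric.sphere (0 : Fin (N + 2) → ℂ) 1 ∧
      ω.IsSolution (L t : ℂ) y ∧ A t *ᵥ ω.data y 0 + B t *ᵥ ω.data y (Fin.last N) = 0 := by
    intro t ht
    obtain ⟨y, h0, h1, h2⟩ := heig t ht
    refine ⟨((‖y‖⁻¹ : ℝ) : ℂ) • y, ?_, h1.smul _, ?_⟩
    · have : ‖y‖ ≠ 0 := norm_ne_zero_iff.mpr h0
      simp [norm_smul, this]
    · rw [ω.data_smul, ω.data_smul, mulVec_smul, mulVec_smul, ← smul_add, h2, smul_zero]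
  obtain ⟨t, -, ht, hts⟩ := exists_seq_strictAnti_tendsto' hsb
  have htI : ∀ n, t n ∈ I := fun n => hI.out hs hb (Set.Ioo_subset_Icc_self (ht n))
  choose y hy1 hy2 hy3 using fun n => hnorm (t n) (htI n)
  -- Eigenfunctions chosen with no continuity still subconverge on the compact unit sphere. The
  -- limit `x` serves as the comparison eigenfunction at `s`.
  obtain ⟨x, hx1, k, hk, hyx⟩ := (isCompact_sphere (0 : Fin (N + 2) → ℂ) 1).tendsto_subseq hy1
  have htk : Tendsto (fun n => t (k n)) atTop (𝓝 s) := hts.comp hk.tendsto_atTop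
  have hLk : Tendsto (fun n => L (t (k n))) atTop (𝓝 (L s)) :=
    (hL s hs).tendsto.comp (tendsto_nhdsWithin_iff.mpr ⟨htk, Eventually.of_forall fun n => htI _⟩)
  have hx2 : ω.IsSolution (L s : ℂ) x :=
    ω.isClosed_isSolution.mem_of_tendsto (hLk.prodMk_nhds hyx) (Eventually.of_forall fun n => hy2 _)
  have hx3 : A s *ᵥ ω.data x 0 + B s *ᵥ ω.data x (Fin.last N) = 0 := by
    have hcl : IsClosed {p : ℝ × (Fin (N + 2) → ℂ) |
        A p.1 *ᵥ ω.data p.2 0 + B p.1 *ᵥ ω.data p.2 (Fin.last N) = 0} :=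
      isClosed_eq (((hA.comp continuous_fst).matrix_mulVec
        ((ω.continuous_data 0).comp continuous_snd)).add ((hB.comp continuous_fst).matrix_mulVec
        ((ω.continuous_data (Fin.last N)).comp continuous_snd))) continuous_const
    exact hcl.mem_of_tendsto (htk.prodMk_nhds hyx) (Eventually.of_forall fun n => hy3 _)
  have hx0 : x ≠ 0 := by
    rintro rfl
    simp at hx1
  have hpos := hx2.weightedInner_self_pos hN hx0
  set g := ∑ i : Fin N, ω.w i * Complex.normSq (x i.succ.castSucc) with hg
  have hself : ω.weightedInner x x = (g : ℂ) := ω.weightedInner_self x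
  have hinner : Tendsto (fun n => ω.weightedInner (y (k n)) x) atTop (𝓝 (g : ℂ)) := by
    rw [← hself]
    exact (ω.continuous_weightedInner_left x).continuousAt.tendsto.comp hyx
  set ψ : (Fin (N + 2) → ℂ) → ℂ := fun y => φ (ω.data y 0) (ω.data y (Fin.last N)) with hψ
  have hψc : Continuous ψ := hφ.comp ((ω.continuous_data 0).prodMk (ω.continuous_data _))
  have hg0 : (g : ℂ) ≠ 0 := by exact_mod_cast hpos.ne'
  have hlim : Tendsto (fun n => (ψ (y (k n)) * conj (ψ x) / ω.weightedInner (y (k n)) x).re) atTop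
      (𝓝 (ψ x * conj (ψ x) / (g : ℂ)).re) :=
    (Complex.continuous_re.tendsto _).comp
      ((((hψc.tendsto x).comp hyx).mul_const _).div hinner hg0)
  have hval : 0 ≤ (ψ x * conj (ψ x) / (g : ℂ)).re := by
    rw [Complex.mul_conj, ← Complex.ofReal_div, Complex.ofReal_re]
    exact div_nonneg (Complex.normSq_nonneg _) hpos.le
  have hev : ∀ᶠ n in atTop, r < slope L s (t (k n)) := by
    -- The inner products tend to `g > 0`, so dividing the Lagrange identity by them is eventually
    -- legitimate.
    filter_upwards [hlim.eventually_const_lt (hr.trans_le hval), hinner.eventually_ne hg0]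
      with n hn hne
    have hid := ω.lagrange_identity (hy2 (k n)) hx2
    rw [hform (t (k n)) s _ _ _ _ (hy3 (k n)) hx3] at hid
    have hst : ((t (k n) : ℂ) - s) ≠ 0 := by
      exact_mod_cast (sub_pos.mpr (ht (k n)).1).ne'
    have hslope : ((slope L s (t (k n)) : ℝ) : ℂ)
        = ψ (y (k n)) * conj (ψ x) / ω.weightedInner (y (k n)) x := by
      rw [slope_def_field]
      push_cast
      rw [div_eq_div_iff hst hne, ← hid]
      ring
    rwa [← hslope, Complex.ofReal_re] at hn
  have hright : Tendsto (fun n => t (k n)) atTop (𝓝[>] s) :=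
    tendsto_nhdsWithin_iff.mpr ⟨htk, Eventually.of_forall fun n => (ht (k n)).1⟩
  exact hright.frequently hev.frequently

/-- A continuous eigenvalue branch increases along a curve of boundary conditions whose boundary
data satisfy the identity of `monotoneOn_eigenvalue`. -/
theorem IsContinuousEigenvalueBranch.increasingAlong (hN : 2 ≤ N) (ω : RealEqn N)
    {D : Set (RealEqn N × SelfAdjBC)} {Λ : RealEqn N × SelfAdjBC → ℝ}
    (hΛ : IsContinuousEigenvalueBranch D Λ)
    {A B P Q : ℝ → Matrix (Fin 2) (Fin 2) ℂ} (hA : Continuous A) (hB : Continuous B)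
    (hr : ∀ s, A s * P s + B s * Q s = 1)
    (hs : ∀ s, A s * !![0, 1; -1, 0] * (A s)ᴴ = B s * !![0, 1; -1, 0] * (B s)ᴴ)
    {φ : (Fin 2 → ℂ) → (Fin 2 → ℂ) → ℂ} (hφ : Continuous fun p : (Fin 2 → ℂ) × _ => φ p.1 p.2)
    (hform : ∀ s t : ℝ, ∀ u v u' v', A s *ᵥ u + B s *ᵥ v = 0 → A t *ᵥ u' + B t *ᵥ v' = 0 →
      bracket v v' - bracket u u' = ((s : ℂ) - t) * (φ u v * conj (φ u' v'))) :
    IncreasingAlong D Λ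
      (fun s => (ω, SelfAdjBC.mk (A s) (B s) (P s) (Q s) (hr s) (hs s))) := by
  intro I hI hc
  have hcont : Continuous fun s : ℝ =>
      (ω, SelfAdjBC.mk (A s) (B s) (P s) (Q s) (hr s) (hs s)) := by
    -- Continuity into the quotient comes from the continuous lift to matrix pairs.
    refine continuous_const.prodMk (Continuous.subtype_mk (continuous_quotient_mk'.comp ?_) _)
    exact (hA.prodMk hB).subtype_mk _
  exact monotoneOn_eigenvalue hN ω hI hA hB hφ hform (hΛ.1.comp hcont.continuousOn hc)
    fun s hsI => hΛ.2 _ (hc hsI)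

end DiscreteSL

end

/-! ### The eight coordinate directions -/

theorem theorem4p6 (N : ℕ) (hN : 2 ≤ N) (ω : DiscreteSL.RealEqn N)
    (D : Set (DiscreteSL.RealEqn N × DiscreteSL.SelfAdjBC))
    (Λ : DiscreteSL.RealEqn N × DiscreteSL.SelfAdjBC → ℝ)
    (hΛ : DiscreteSL.IsContinuousEigenvalueBranch D Λ) :
    ((∀ (z : ℂ) (b22 : ℝ),
        DiscreteSL.IncreasingAlong D Λ (fun s => (ω, DiscreteSL.chart13 s z b22))) ∧
      (∀ (a12 : ℝ) (z : ℂ),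
        DiscreteSL.IncreasingAlong D Λ (fun s => (ω, DiscreteSL.chart13 a12 z s)))) ∧
    ((∀ (z : ℂ) (b21 : ℝ),
        DiscreteSL.IncreasingAlong D Λ (fun s => (ω, DiscreteSL.chart14 s z b21))) ∧
      (∀ (a12 : ℝ) (z : ℂ),
        DiscreteSL.IncreasingAlong D Λ (fun s => (ω, DiscreteSL.chart14 a12 z s)))) ∧
    ((∀ (z : ℂ) (b22 : ℝ),
        DiscreteSL.IncreasingAlong D Λ (fun s => (ω, DiscreteSL.chart23 s z b22))) ∧
      (∀ (a11 : ℝ) (z : ℂ),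
        DiscreteSL.IncreasingAlong D Λ (fun s => (ω, DiscreteSL.chart23 a11 z s)))) ∧
    ((∀ (z : ℂ) (b21 : ℝ),
        DiscreteSL.IncreasingAlong D Λ (fun s => (ω, DiscreteSL.chart24 s z b21))) ∧
      (∀ (a11 : ℝ) (z : ℂ),
        DiscreteSL.IncreasingAlong D Λ (fun s => (ω, DiscreteSL.chart24 a11 z s)))) := by
  -- In each direction `φ` is the component of the boundary data that the moving coordinate
  -- multiplies.
  refine ⟨⟨fun _ _ => hΛ.increasingAlong hN ω (φ := fun u _ => u 1)
      (by fun_prop) (by fun_prop) _ _ (by fun_prop) ?_,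
    fun _ _ => hΛ.increasingAlong hN ω (φ := fun _ v => v 1)
      (by fun_prop) (by fun_prop) _ _ (by fun_prop) ?_⟩,
    ⟨fun _ _ => hΛ.increasingAlong hN ω (φ := fun u _ => u 1)
      (by fun_prop) (by fun_prop) _ _ (by fun_prop) ?_,
    fun _ _ => hΛ.increasingAlong hN ω (φ := fun _ v => v 0)
      (by fun_prop) (by fun_prop) _ _ (by fun_prop) ?_⟩,
    ⟨fun _ _ => hΛ.increasingAlong hN ω (φ := fun u _ => u 0)
      (by fun_prop) (by fun_prop) _ _ (by fun_prop) ?_,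
    fun _ _ => hΛ.increasingAlong hN ω (φ := fun _ v => v 1)
      (by fun_prop) (by fun_prop) _ _ (by fun_prop) ?_⟩,
    ⟨fun _ _ => hΛ.increasingAlong hN ω (φ := fun u _ => u 0)
      (by fun_prop) (by fun_prop) _ _ (by fun_prop) ?_,
    fun _ _ => hΛ.increasingAlong hN ω (φ := fun _ v => v 0)
      (by fun_prop) (by fun_prop) _ _ (by fun_prop) ?_⟩⟩
  all_goals
    intro s t u v u' v' h h'
    have h0 := congrFun h 0
    have h1 := congrFun h 1
    have k0 := congrArg conj (congrFun h' 0)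
    have k1 := congrArg conj (congrFun h' 1)
    simp [dotProduct, Fin.sum_univ_two] at h0 h1 k0 k1
    simp only [DiscreteSL.bracket]
  -- Each row is paired with the conjugate of the component multiplied by that row's real
  -- coordinate. The `z` terms cancel between the rows, the fixed coordinate drops out, and the
  -- signs of the pivots leave `+(s - t)` in every chart.
  · linear_combination -h0 * conj (u' 1) + u 1 * k0 - h1 * conj (v' 1) + v 1 * k1
  · linear_combination -h0 * conj (u' 1) + u 1 * k0 - h1 * conj (v' 1) + v 1 * k1
  · linear_combination -h0 * conj (u' 1) + u 1 * k0 - h1 * conj (v' 0) + v 0 * k1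
  · linear_combination -h0 * conj (u' 1) + u 1 * k0 - h1 * conj (v' 0) + v 0 * k1
  · linear_combination -h0 * conj (u' 0) + u 0 * k0 - h1 * conj (v' 1) + v 1 * k1
  · linear_combination -h0 * conj (u' 0) + u 0 * k0 - h1 * conj (v' 1) + v 1 * k1
  · linear_combination -h0 * conj (u' 0) + u 0 * k0 - h1 * conj (v' 0) + v 0 * k1
  · linear_combination -h0 * conj (u' 0) + u 0 * k0 - h1 * conj (v' 0) + v 0 * k1
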